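/- Let $\mathcal N$ be the vector matroid over $\mathbb Q$ on the ground set $E=\{e_1,\dots,e_{10}\}$ given by the columns of \[ N=\begin{pmatrix} 2&1&3&3&-1&-1&0&0&-1&-1\\ 1&1&1&1&1&1&1&1&0&0\\ 0&0&0&0&0&0&-1&-1&1&1 \end{pmatrix}, \] and let $M=\mathcal N^{*}$ be its dual, ordered by $e_1<e_2<\dots<e_{10}$. Definitions. Let $B_0$ be the lexicographically first basis of $M$. For a basis $B$, an element $e\in B$ is internally active if it is the least element of its fundamental cocircuit with respect to $B$, and internally passive otherwise; $IP(B)$ is the set of internally passive elements of $B$. Put $S(B)=IP(B)\setminus B_0$ and $T(B)=IP(B)\cap B_0$. The internal order on bases is $B\le B'$ iff $IP(B)\subseteq IP(B')$. A basis $P$ is $f$-principal if $S(P)=\{f\}$. For $f\in S(B)$ let $T(B;f)$ be the union of the sets $T(P)$ over all $f$-principal bases $P\le B$ (equivalently, $T(P)$ for the greatest such $P$). The basis $B$ is internally perfect if $T(B)=\bigsqcup_{f\in S(B)}T(B;f)$ (disjoint union), and the ordered matroid $M$ is internally perfect if all its bases are. Then $\mathcal N$ has rank $3$, $M$ has rank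 $7$, and $M$ is internally perfect. Moreover $M$ is "interesting": writing $n=10$ for the number of elements, $r$ for the rank of $M$, and $h(M)=(h_0,\dots,h_s,0,\dots,0)$ with $h_s\neq 0$ for the $h$-vector of $M$ (defined by $\sum_{j=0}^r h_jx^j=\sum_{i=0}^r f_i x^i(1-x)^{r-i}$, where $f_i$ is the number of independent sets of size $i$), none of the following eight properties holds: \begin{enumerate} \item $M^{*}$ is graphic, i.e. it is the cycle matroid of a multigraph; \item $M^{*}$ is transversal, i.e. its independent sets are the partial transversals of a finite family of sets; \item $M^{*}$ has at most $n-r+2$ parallel classes; \item $n\le 9$ or $\operatorname{rank}(M^{*})\le 2$; \item $r\le 4$; \item $M$ is paving, i.e. every circuit has at least $r$ elements; \item $M$ is a truncation, i.e. for some matroid $M'$ on $E$ and some $k<\operatorname{rank}(M')$ the independent sets of $M$ are the independent sets of $M'$ with at most $k$ elements; \item $h_s\le 5$. \end{enumerate} -/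

import Mathlib

universe u

namespace Matroid

variable {α : Type u}

section VectorMatroid

/-- The vector matroid of a finite family of vectors: the ground set is the index set, and a set of
indices is independent when the corresponding subfamily is linearly independent. -/
noncomputable def vectorMatroid (K : Type*) {W : Type*} [Field K] [AddCommGroup W] [Module K W]
    [Finite α] (v : α → W) : Matroid α :=
  (IndepMatroid.ofFinite (E := Set.univ) Set.finite_univ (fun I => LinearIndepOn K v I)
    (linearIndepOn_empty K v)
    (fun _ _ hJ hIJ => hJ.mono hIJ)
    (by
      intro I J hI hJ hlt
      by_contra hcon
      push Not at hcon
      have hfI : Fintype I := Fintype.ofFinite I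
      have hfJ : Fintype J := Fintype.ofFinite J
      have hsub : v '' J ⊆ Submodule.span K (v '' I) := by
        rintro _ ⟨e, he, rfl⟩
        by_cases heI : e ∈ I
        · exact Submodule.subset_span ⟨e, heI, rfl⟩
        · by_contra hns
          exact hcon e he heI (hI.insert hns)
      have hle : Submodule.span K (v '' J) ≤ Submodule.span K (v '' I) :=
        Submodule.span_le.2 hsub
      have hfin : FiniteDimensional K (Submodule.span K (v '' I)) :=
        FiniteDimensional.span_of_finite K (Set.toFinite _)
      have hr := Submodule.finrank_mono hle
      have eI := finrank_span_eq_card (R := K) (show LinearIndependent K (fun x : I => v x) from hI)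
      have eJ := finrank_span_eq_card (R := K) (show LinearIndependent K (fun x : J => v x) from hJ)
      rw [show Set.range (fun x : I => v x) = v '' I from (Set.image_eq_range v I).symm] at eI
      rw [show Set.range (fun x : J => v x) = v '' J from (Set.image_eq_range v J).symm] at eJ
      rw [eI, eJ, ← Nat.card_eq_fintype_card, ← Nat.card_eq_fintype_card] at hr
      exact absurd hr (not_le.2 hlt))
    (fun _ _ => Set.subset_univ _)).matroid

end VectorMatroid

section InternalOrder

variable [LinearOrder α]

/-- `B₀` is the initial (lexicographically first) basis of the ordered matroid `M`: for every other
basis `B`, the least element in which `B₀` and `B` differ belongs to `B₀`. -/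
def IsInitialBase (M : Matroid α) (B₀ : Set α) : Prop :=
  M.IsBase B₀ ∧ ∀ B, M.IsBase B → B ≠ B₀ →
    ∃ x ∈ B₀ \ B, ∀ y < x, (y ∈ B₀ ↔ y ∈ B)

/-- `e` is internally active in the basis `B`: it is the least element of its fundamental
cocircuit. -/
def InternallyActive (M : Matroid α) (B : Set α) (e : α) : Prop :=
  e ∈ B ∧ ∀ f ∈ M.fundCocircuit e B, e ≤ f

/-- `IP(B)`: the internally passive elements of the basis `B`. -/
def internallyPassive (M : Matroid α) (B : Set α) : Set α :=
  {e | e ∈ B ∧ ¬ M.InternallyActive B e}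

/-- The internal order on bases: inclusion of the sets of internally passive elements. -/
def InternalLE (M : Matroid α) (B B' : Set α) : Prop :=
  M.internallyPassive B ⊆ M.internallyPassive B'

/-- `S(B)`: the internally passive elements of `B` outside the initial basis `B₀`. -/
def internalS (M : Matroid α) (B₀ B : Set α) : Set α := M.internallyPassive B \ B₀

/-- `T(B)`: the internally passive elements of `B` in the initial basis `B₀`. -/
def internalT (M : Matroid α) (B₀ B : Set α) : Set α := M.internallyPassive B ∩ B₀

/-- `P` is an `f`-principal basis: `S(P) = {f}`. -/
def IsPrincipalBase (M : Matroid α) (B₀ : Set α) (f : α) (P : Set α) : Prop :=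
  M.IsBase P ∧ M.internalS B₀ P = {f}

/-- `T(B;f)`, the `f`-part of `T(B)`: the union of the sets `T(P)` over the `f`-principal bases `P`
below `B` in the internal order (equivalently, `T(P)` for the greatest such `P`). -/
def internalPart (M : Matroid α) (B₀ B : Set α) (f : α) : Set α :=
  {t | ∃ P, M.IsPrincipalBase B₀ f P ∧ M.InternalLE P B ∧ t ∈ M.internalT B₀ P}

/-- A basis `B` is internally perfect if `T(B)` is the disjoint union of its `f`-parts, `f` running
over `S(B)`. -/
def IsPerfectBase (M : Matroid α) (B₀ B : Set α) : Prop :=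
  (⋃ f ∈ M.internalS B₀ B, M.internalPart B₀ B f) = M.internalT B₀ B ∧
    (M.internalS B₀ B).PairwiseDisjoint (M.internalPart B₀ B)

/-- An ordered matroid is internally perfect if all of its bases are. -/
def IsInternallyPerfect (M : Matroid α) : Prop :=
  ∃ B₀, M.IsInitialBase B₀ ∧ ∀ B, M.IsBase B → M.IsPerfectBase B₀ B

end InternalOrder

/-- `C` is the edge set of a cycle of the (multi)graph `G`: there are `k + 1 ≥ 1` distinct vertices
`v 0, …, v k` and distinct edges `e 0, …, e k`, the edge `e i` joining `v i` to `v (i + 1)`, with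
indices modulo `k + 1` (so `k = 0` is a loop and `k = 1` a pair of parallel edges). -/
def IsGraphCycle {V : Type*} (G : Graph V α) (C : Set α) : Prop :=
  ∃ (k : ℕ) (v : Fin (k + 1) → V) (e : Fin (k + 1) → α),
    Function.Injective v ∧ Function.Injective e ∧
      (∀ i, G.IsLink (e i) (v i) (v (i + 1))) ∧ C = Set.range e

/-- `M` is graphic: its circuits are the edge sets of the cycles of some (multi)graph. -/
def IsGraphic (M : Matroid α) : Prop :=
  ∃ (V : Type u) (G : Graph V α), G.edgeSet = M.E ∧ ∀ C, M.IsCircuit C ↔ IsGraphCycle G C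

/-- `M` is transversal: its independent sets are the partial transversals of a finite family of
subsets of its ground set. -/
def IsTransversal (M : Matroid α) : Prop :=
  ∃ (m : ℕ) (A : Fin m → Set α), (∀ j, A j ⊆ M.E) ∧
    ∀ I, I ⊆ M.E → (M.Indep I ↔ ∃ φ : I → Fin m, Function.Injective φ ∧ ∀ e : I, (e : α) ∈ A (φ e))

/-- The set of parallel classes of `M`; the class of a nonloop `e` consists of the nonloops in the
closure of `{e}`. -/
def parallelClasses (M : Matroid α) : Set (Set α) :=
  {P | ∃ e, M.IsNonloop e ∧ P = {f | M.IsNonloop f ∧ f ∈ M.closure {e}}}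

/-- `M` is paving: every circuit has at least `rank M` elements. -/
def IsPaving (M : Matroid α) : Prop := ∀ C, M.IsCircuit C → M.eRank ≤ C.encard

/-- `M` is a truncation: for some matroid `N` on the same ground set and some `k < rank N`, the
independent sets of `M` are the independent sets of `N` with at most `k` elements. -/
def IsTruncation (M : Matroid α) : Prop :=
  ∃ (N : Matroid α) (k : ℕ), N.E = M.E ∧ (k : ℕ∞) < N.eRank ∧
    ∀ I, M.Indep I ↔ N.Indep I ∧ I.encard ≤ k

/-- The number of independent sets with `i` elements. -/
noncomputable def numIndep (M : Matroid α) (i : ℕ) : ℕ := {I | M.Indep I ∧ I.encard = i}.ncard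

/-- The entry `h_j`, for `0 ≤ j ≤ r = rank M`, of the `h`-vector of (the independence complex of)
the finite matroid `M`, so that `∑ h_j x^j = ∑ f_i x^i (1 - x)^(r - i)` where `f_i` is the number
of independent sets with `i` elements. -/
noncomputable def hEntry (M : Matroid α) (j : ℕ) : ℤ :=
  ∑ i ∈ Finset.range (j + 1),
    (-1) ^ (j - i) * ((M.eRank.toNat - i).choose (j - i) : ℤ) * (M.numIndep i : ℤ)

/-- The `h`-vector of `M` is `(h_0, …, h_s, 0, …, 0)` with `h_s` nonzero. -/
def IsLastHIndex (M : Matroid α) (s : ℕ) : Prop :=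
  s ≤ M.eRank.toNat ∧ M.hEntry s ≠ 0 ∧ ∀ j, s < j → j ≤ M.eRank.toNat → M.hEntry j = 0

/-- The matrix whose columns are the vectors `e₁, …, e₁₀` (indexed by `0, …, 9`). -/
def exampleMatrix : Matrix (Fin 3) (Fin 10) ℚ :=
  !![2, 1, 3, 3, -1, -1,  0,  0, -1, -1;
     1, 1, 1, 1,  1,  1,  1,  1,  0,  0;
     0, 0, 0, 0,  0,  0, -1, -1,  1,  1]

/-- The vector matroid over `ℚ` of the columns of `exampleMatrix`. -/
noncomputable def exampleN : Matroid (Fin 10) := vectorMatroid ℚ exampleMatrix.col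

/-- The dual of `exampleN`, ordered by the order of the columns. -/
noncomputable def exampleM : Matroid (Fin 10) := exampleN✶

end Matroid

/-!
The matroid `N = exampleN` has rank `3`, so everything is governed by which `3 × 3` minors of its
matrix vanish: the bases of `M = N✶` are the complements of the triples `{i, j, k}` with
`columnDet i j k ≠ 0` (`exampleM_isBase_iff`), and there are `68` of them.

*Internal perfection.* An element `x` of the basis `{i, j, k}ᶜ` is internally passive exactly when
it may replace a smaller element of `{i, j, k}` in a basis of `N`, since its fundamental cocircuit
in `M` is its fundamental circuit in `N` with respect to `{i, j, k}` (`internallyPassive_eq`). The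
initial basis is the complement of `{3, 7, 9}`, and the principal bases form one chain for each of
`3`, `7` and `9` (`principalFinsets`). A finite check shows that every passive element of a basis
lying in the initial basis is already passive in some principal basis below it
(`exists_principal_of_mem_passive`). The parts are disjoint because two principal bases for
different elements that share a passive element of the initial basis have passive sets whose union
is dependent in `M` (`inter_subset_of_principal_of_ne`), so that no basis lies above both.

*The excluded properties.* `N` is not graphic, because the columns `0`, `1`, `2`, `4` form a
four-element line, whereas triangles on `{a, b, c}` and `{a, b, d}` in a graph make `c` and `d`
parallel (`IsGraphic.isCircuit_pair`). It is not transversal, because the parallel pairs `{4, 5}`,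
`{6, 7}`, `{8, 9}` lie on a common line, whereas by Hall's theorem the elements of a parallel pair
lie in only one member of a presentation, and the members for three pairwise nonparallel pairs are
distinct, hence give a transversal (`IsTransversal.indep_triple`). `M` is not a truncation, because
the truncated matroid would have an independent set of `8` elements all of whose `7`-subsets are
bases of `M`, and then every triple through the complementary pair would be a basis of `N`
(`exampleM_not_isTruncation`). The complement of the line `{0, …, 5}` is a dependent set of `M` with
four elements, so `M` is not paving. The columns `0`, `1`, `2`, `4`, `6`, `8` are pairwise
nonparallel, which gives at least six parallel classes. The last entry `h₇ = 6` of the `h`-vector comes from counting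
the independent sets of each size.
-/

namespace Matroid

/-! ### Bases of the vector matroid -/

@[simp] lemma exampleN_ground : exampleN.E = Set.univ := rfl

@[simp] lemma exampleM_ground : exampleM.E = Set.univ := rfl

lemma exampleM_dual : exampleM✶ = exampleN := dual_dual _

/-- The entries of `exampleMatrix` as integers, listed column by column. -/
def columnEntry : Fin 10 → Fin 3 → ℤ :=
  ![![2, 1, 0], ![1, 1, 0], ![3, 1, 0], ![3, 1, 0], ![-1, 1, 0], ![-1, 1, 0],
    ![0, 1, -1], ![0, 1, -1], ![-1, 0, 1], ![-1, 0, 1]]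

/-- The determinant of three columns of `exampleMatrix`, as an integer. -/
def columnDet (i j k : Fin 10) : ℤ :=
  columnEntry i 0 * (columnEntry j 1 * columnEntry k 2 - columnEntry j 2 * columnEntry k 1)
    - columnEntry i 1 * (columnEntry j 0 * columnEntry k 2 - columnEntry j 2 * columnEntry k 0)
    + columnEntry i 2 * (columnEntry j 0 * columnEntry k 1 - columnEntry j 1 * columnEntry k 0)

lemma exampleMatrix_eq_columnEntry (r : Fin 3) (i : Fin 10) :
    exampleMatrix r i = (columnEntry i r : ℚ) := by
  fin_cases r <;> fin_cases i <;> simp [exampleMatrix, columnEntry]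

lemma det_columns (i j k : Fin 10) :
    (Matrix.of ![exampleMatrix.col i, exampleMatrix.col j, exampleMatrix.col k]).det
      = (columnDet i j k : ℚ) := by
  simp only [Matrix.det_fin_three, columnDet, Matrix.of_apply, Matrix.cons_val, Matrix.col_apply,
    exampleMatrix_eq_columnEntry]
  push_cast
  ring

lemma columnDet_ne_zero_iff_linearIndependent (i j k : Fin 10) :
    columnDet i j k ≠ 0 ↔ LinearIndependent ℚ (exampleMatrix.col ∘ ![i, j, k]) := by
  have h : exampleMatrix.col ∘ ![i, j, k] =
      (Matrix.of ![exampleMatrix.col i, exampleMatrix.col j, exampleMatrix.col k]).row := by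
    funext t
    fin_cases t <;> rfl
  rw [h, Matrix.linearIndependent_rows_iff_isUnit, Matrix.isUnit_iff_isUnit_det, det_columns,
    isUnit_iff_ne_zero, Int.cast_ne_zero]

lemma range_triple {α : Type*} (i j k : α) : Set.range ![i, j, k] = {i, j, k} := by
  rw [Matrix.range_cons, Matrix.range_cons_cons_empty]
  rfl

lemma exampleN_indep_triple {i j k : Fin 10} (h : columnDet i j k ≠ 0) :
    exampleN.Indep {i, j, k} ∧ ({i, j, k} : Set (Fin 10)).encard = 3 := by
  rw [columnDet_ne_zero_iff_linearIndependent] at h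
  have hinj : Function.Injective ![i, j, k] := h.injective.of_comp
  rw [← range_triple]
  refine ⟨(linearIndepOn_range_iff hinj _).2 h, ?_⟩
  rw [← Set.image_univ, hinj.encard_image, Set.encard_univ]
  simp

lemma exampleN_encard_le {I : Set (Fin 10)} (hI : exampleN.Indep I) : I.encard ≤ 3 := by
  have h : LinearIndependent ℚ (fun x : I ↦ exampleMatrix.col x) := hI
  have : Fintype I := Fintype.ofFinite I
  have := h.fintype_card_le_finrank
  rw [Module.finrank_fin_fun] at this
  rw [← Set.coe_fintypeCard]
  exact_mod_cast this

lemma exampleN_eRank : exampleN.eRank = 3 := by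
  obtain ⟨B, hB⟩ := exampleN.exists_isBase
  refine le_antisymm (hB.encard_eq_eRank ▸ exampleN_encard_le hB.indep) ?_
  obtain ⟨hI, hc⟩ := exampleN_indep_triple (i := 0) (j := 1) (k := 9) (by decide)
  exact hc ▸ hI.encard_le_eRank

lemma exampleN_isBase_iff_indep (B : Set (Fin 10)) :
    exampleN.IsBase B ↔ exampleN.Indep B ∧ B.encard = 3 := by
  refine ⟨fun h ↦ ⟨h.indep, h.encard_eq_eRank.trans exampleN_eRank⟩, fun ⟨h, hc⟩ ↦ ?_⟩
  refine h.isBase_of_eRk_ge B.toFinite ?_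
  rw [h.eRk_eq_encard, hc, exampleN_eRank]

lemma exampleN_isBase_triple (i j k : Fin 10) :
    exampleN.IsBase {i, j, k} ↔ columnDet i j k ≠ 0 := by
  refine ⟨fun h ↦ ?_, fun h ↦ (exampleN_isBase_iff_indep _).2 (exampleN_indep_triple h)⟩
  obtain ⟨hI, hc⟩ := (exampleN_isBase_iff_indep _).1 h
  rw [columnDet_ne_zero_iff_linearIndependent]
  rw [← range_triple] at hI hc
  refine (linearIndepOn_range_iff ?_ _).1 hI
  have hcard : (Finset.univ.image ![i, j, k]).card = Fintype.card (Fin 3) := by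
    rw [← Set.image_univ, ← Finset.coe_univ, ← Finset.coe_image,
      Set.encard_coe_eq_coe_finsetCard] at hc
    exact_mod_cast hc
  exact Set.injOn_univ.1 (by simpa using Finset.card_image_iff.1 hcard)

/-- The bases of `exampleN`, parametrized by increasing triples of indices. -/
lemma exampleN_isBase_iff (B : Set (Fin 10)) :
    exampleN.IsBase B ↔ ∃ i j k, i < j ∧ j < k ∧ columnDet i j k ≠ 0 ∧ B = {i, j, k} := by
  constructor
  · intro h
    obtain ⟨x, y, z, hxy, hxz, hyz, rfl⟩ :=
      Set.encard_eq_three.1 ((exampleN_isBase_iff_indep B).1 h).2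
    have key : ∃ i j k : Fin 10, i < j ∧ j < k ∧ ({x, y, z} : Set (Fin 10)) = {i, j, k} := by
      rcases hxy.lt_or_gt with h1 | h1 <;> rcases hxz.lt_or_gt with h2 | h2 <;>
        rcases hyz.lt_or_gt with h3 | h3
      · exact ⟨x, y, z, h1, h3, rfl⟩
      · exact ⟨x, z, y, h2, h3, by grind⟩
      · omega
      · exact ⟨z, x, y, h2, h1, by grind⟩
      · exact ⟨y, x, z, h1, h2, by grind⟩
      · omega
      · exact ⟨y, z, x, h3, h2, by grind⟩
      · exact ⟨z, y, x, h3, h1, by grind⟩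
    obtain ⟨i, j, k, hij, hjk, heq⟩ := key
    exact ⟨i, j, k, hij, hjk, (exampleN_isBase_triple i j k).1 (heq ▸ h), heq⟩
  · rintro ⟨i, j, k, -, -, h, rfl⟩
    exact (exampleN_isBase_triple i j k).2 h

lemma exampleM_isBase_iff (B : Set (Fin 10)) :
    exampleM.IsBase B ↔ ∃ i j k, i < j ∧ j < k ∧ columnDet i j k ≠ 0 ∧ B = {i, j, k}ᶜ := by
  rw [exampleM, dual_isBase_iff, exampleN_ground, ← Set.compl_eq_univ_sdiff, exampleN_isBase_iff]
  simp only [compl_eq_comm (x := B), eq_comm (b := B)]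

lemma exampleM_eRank : exampleM.eRank = 7 := by
  have h : exampleM.IsBase {0, 1, 9}ᶜ :=
    (exampleM_isBase_iff _).2 ⟨0, 1, 9, by decide, by decide, by decide, rfl⟩
  have h2 := Set.encard_add_encard_compl ({0, 1, 9} : Set (Fin 10))
  rw [add_comm, (exampleN_indep_triple (by decide : columnDet 0 1 9 ≠ 0)).2, h.encard_eq_eRank,
    Set.encard_univ] at h2
  refine ENat.add_left_injective_of_ne_top (ENat.natCast_ne_top 3) (h2.trans ?_)
  norm_num

lemma exampleN_indep_triple_iff {a b c : Fin 10} (hab : a ≠ b) (hac : a ≠ c) (hbc : b ≠ c) :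
    exampleN.Indep {a, b, c} ↔ columnDet a b c ≠ 0 := by
  rw [← exampleN_isBase_triple, exampleN_isBase_iff_indep,
    and_iff_left (Set.encard_eq_three.2 ⟨a, b, c, hab, hac, hbc, rfl⟩)]

/-- Two columns are independent exactly when they extend to an invertible `3 × 3` matrix. -/
lemma exampleN_indep_pair {a b : Fin 10} (hab : a ≠ b) :
    exampleN.Indep {a, b} ↔ ∃ c, columnDet a b c ≠ 0 := by
  constructor
  · intro h
    obtain ⟨B, hB, hIB⟩ := h.exists_isBase_superset
    obtain ⟨c, hc, rfl⟩ : ∃ c, c ∉ ({a, b} : Set (Fin 10)) ∧ B = insert c {a, b} := by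
      have h3 := ((exampleN_isBase_iff_indep B).1 hB).2
      have h2 : (B \ {a, b}).encard + 2 = 1 + 2 := by
        rw [← Set.encard_pair hab, Set.encard_sdiff_add_encard_of_subset hIB, h3,
          Set.encard_pair hab]
        norm_num
      obtain ⟨c, hc⟩ := Set.encard_eq_one.1
        (ENat.add_left_injective_of_ne_top (ENat.natCast_ne_top 2) h2)
      have hcm : c ∈ B \ {a, b} := hc ▸ rfl
      refine ⟨c, hcm.2, ?_⟩
      rw [← Set.sdiff_union_of_subset hIB, hc]
      rfl
    refine ⟨c, (exampleN_isBase_triple a b c).1 ?_⟩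
    convert hB using 1
    grind
  · rintro ⟨c, hc⟩
    exact (exampleN_indep_triple hc).1.subset (by grind)

/-! ### The dual is not graphic -/

/-- The edges of a cycle of length three form a triangle, in whichever order they are named. -/
lemma IsGraphCycle.exists_triangle {V α : Type*} {G : Graph V α} {a b c : α} (hab : a ≠ b)
    (hac : a ≠ c) (hbc : b ≠ c) (h : IsGraphCycle G {a, b, c}) :
    ∃ p q r, r ≠ p ∧ G.IsLink a p q ∧ G.IsLink b q r ∧ G.IsLink c r p := by
  obtain ⟨k, v, e, hv, he, hl, hC⟩ := h
  have hk : k = 2 := by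
    have h1 : ({a, b, c} : Set α).encard = (k + 1 : ℕ) := by
      rw [hC, ← Set.image_univ, he.encard_image, Set.encard_univ]
      simp
    rw [Set.encard_eq_three.2 ⟨a, b, c, hab, hac, hbc, rfl⟩] at h1
    have : 3 = k + 1 := by exact_mod_cast h1
    omega
  subst hk
  have l0 : G.IsLink (e 0) (v 0) (v 1) := hl 0
  have l1 : G.IsLink (e 1) (v 1) (v 2) := hl 1
  have l2 : G.IsLink (e 2) (v 2) (v 0) := hl 2
  have n01 : v 0 ≠ v 1 := hv.ne (by decide)
  have n12 : v 1 ≠ v 2 := hv.ne (by decide)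
  have n02 : v 0 ≠ v 2 := hv.ne (by decide)
  obtain ⟨x, rfl⟩ : a ∈ Set.range e := hC ▸ by simp
  obtain ⟨y, rfl⟩ : b ∈ Set.range e := hC ▸ by simp
  obtain ⟨z, rfl⟩ : c ∈ Set.range e := hC ▸ by simp
  have hxyz : ∀ x y z : Fin 3, x ≠ y → x ≠ z → y ≠ z →
      (x = 0 ∧ y = 1 ∧ z = 2) ∨ (x = 0 ∧ y = 2 ∧ z = 1) ∨ (x = 1 ∧ y = 0 ∧ z = 2) ∨
      (x = 1 ∧ y = 2 ∧ z = 0) ∨ (x = 2 ∧ y = 0 ∧ z = 1) ∨ (x = 2 ∧ y = 1 ∧ z = 0) := by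
    decide
  rcases hxyz x y z (he.ne_iff.1 hab) (he.ne_iff.1 hac) (he.ne_iff.1 hbc) with
    ⟨rfl, rfl, rfl⟩ | ⟨rfl, rfl, rfl⟩ | ⟨rfl, rfl, rfl⟩ | ⟨rfl, rfl, rfl⟩ | ⟨rfl, rfl, rfl⟩ |
    ⟨rfl, rfl, rfl⟩
  · exact ⟨_, _, _, n02.symm, l0, l1, l2⟩
  · exact ⟨_, _, _, n12.symm, l0.symm, l2.symm, l1.symm⟩
  · exact ⟨_, _, _, n02, l1.symm, l0.symm, l2.symm⟩
  · exact ⟨_, _, _, n01, l1, l2, l0⟩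
  · exact ⟨_, _, _, n12, l2, l0, l1⟩
  · exact ⟨_, _, _, n01.symm, l2.symm, l1.symm, l0.symm⟩

/-- A graphic matroid has no restriction to a four-element line: triangles on `{a, b, c}` and on
`{a, b, d}` force `c` and `d` to be parallel. -/
lemma IsGraphic.isCircuit_pair {α : Type*} {M : Matroid α} (hM : M.IsGraphic) {a b c d : α}
    (hab : a ≠ b) (hac : a ≠ c) (hbc : b ≠ c) (had : a ≠ d) (hbd : b ≠ d) (hcd : c ≠ d)
    (h₁ : M.IsCircuit {a, b, c}) (h₂ : M.IsCircuit {a, b, d}) : M.IsCircuit {c, d} := by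
  obtain ⟨V, G, -, hG⟩ := hM
  obtain ⟨p, q, r, hrp, la, lb, lc⟩ := ((hG _).1 h₁).exists_triangle hab hac hbc
  obtain ⟨p', q', r', hrp', la', lb', ld⟩ := ((hG _).1 h₂).exists_triangle hab had hbd
  have hd : G.IsLink d p r := by
    rcases la.eq_and_eq_or_eq_and_eq la' with ⟨rfl, rfl⟩ | ⟨rfl, rfl⟩
    · exact (lb.right_unique lb') ▸ ld.symm
    · -- the two triangles traverse `a` in opposite directions
      rcases lb.eq_and_eq_or_eq_and_eq lb' with ⟨rfl, rfl⟩ | ⟨rfl, rfl⟩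
      · exact ld.symm
      · exact absurd rfl hrp
  refine (hG _).2 ⟨1, ![r, p], ![c, d], ?_, ?_, ?_, ?_⟩
  · intro x y
    fin_cases x <;> fin_cases y <;> simp [hrp, hrp.symm]
  · intro x y
    fin_cases x <;> fin_cases y <;> simp [hcd, hcd.symm]
  · intro x
    fin_cases x
    · exact lc
    · exact hd
  · simp [Set.pair_comm]

lemma exampleN_isCircuit_triple {a b c : Fin 10} (hab : a ≠ b) (hac : a ≠ c) (hbc : b ≠ c)
    (h : columnDet a b c = 0) (h₁ : ∃ x, columnDet a b x ≠ 0) (h₂ : ∃ x, columnDet a c x ≠ 0)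
    (h₃ : ∃ x, columnDet b c x ≠ 0) : exampleN.IsCircuit {a, b, c} := by
  rw [isCircuit_iff_dep_forall_sdiff_singleton_indep, dep_iff,
    exampleN_indep_triple_iff hab hac hbc]
  refine ⟨⟨not_not.2 h, Set.subset_univ _⟩, ?_⟩
  rintro e (rfl | rfl | rfl)
  · convert (exampleN_indep_pair hbc).2 h₃ using 1
    grind
  · convert (exampleN_indep_pair hac).2 h₂ using 1
    grind
  · convert (exampleN_indep_pair hab).2 h₁ using 1
    grind

lemma exampleN_not_isGraphic : ¬ exampleN.IsGraphic := by
  intro h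
  have hc : exampleN.IsCircuit {2, 4} :=
    h.isCircuit_pair (a := 0) (b := 1) (by decide) (by decide) (by decide) (by decide)
      (by decide) (by decide)
      (exampleN_isCircuit_triple (by decide) (by decide) (by decide) (by decide) (by decide)
        (by decide) (by decide))
      (exampleN_isCircuit_triple (by decide) (by decide) (by decide) (by decide) (by decide)
        (by decide) (by decide))
  exact hc.not_indep ((exampleN_indep_pair (by decide)).2 (by decide))

/-! ### The dual is not transversal -/

/-- In a presentation of a transversal matroid, a nonloop with another nonloop parallel to
it lies in only one member of the family: a second one would make room for both. -/
lemma exists_forall_mem_eq_of_parallel {α : Type*} {M : Matroid α} {m : ℕ} {A : Fin m → Set α}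
    (hA : ∀ I, I ⊆ M.E →
      (M.Indep I ↔ ∃ φ : I → Fin m, Function.Injective φ ∧ ∀ e : I, (e : α) ∈ A (φ e)))
    {x y : α} (hx : M.IsNonloop x) (hy : M.IsNonloop y) (hxy : ¬ M.Indep {x, y}) :
    ∃ j, ∀ l, x ∈ A l → l = j := by
  obtain ⟨ψ, -, hψ⟩ := (hA _ hy.indep.subset_ground).1 hy.indep
  refine ⟨ψ ⟨y, rfl⟩, fun l hl ↦ by_contra fun hne ↦ hxy ?_⟩
  classical
  refine (hA _ (Set.pair_subset hx.mem_ground hy.mem_ground)).2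
    ⟨fun e ↦ if (e : α) = x then l else ψ ⟨y, rfl⟩, ?_, ?_⟩
  · rintro ⟨e, he⟩ ⟨f, hf⟩ h
    simp only [Set.mem_insert_iff, Set.mem_singleton_iff] at he hf
    grind
  · rintro ⟨e, he⟩
    by_cases hex : e = x
    · simpa [hex] using hl
    · obtain rfl : e = y := he.resolve_left hex
      simpa [hex] using hψ ⟨e, rfl⟩

/-- In a transversal matroid, three pairwise independent elements, each of which has another
element parallel to it, are independent: each of them lies in a single member of the family, and
these members are distinct. -/
lemma IsTransversal.indep_triple {α : Type*} {M : Matroid α} (hM : M.IsTransversal)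
    {x y z x' y' z' : α} (hx' : M.IsNonloop x') (hy' : M.IsNonloop y') (hz' : M.IsNonloop z')
    (hxx' : ¬ M.Indep {x, x'}) (hyy' : ¬ M.Indep {y, y'}) (hzz' : ¬ M.Indep {z, z'})
    (hxy : M.Indep {x, y}) (hxz : M.Indep {x, z}) (hyz : M.Indep {y, z}) (hne : x ≠ y)
    (hne' : x ≠ z) (hne'' : y ≠ z) : M.Indep {x, y, z} := by
  obtain ⟨m, A, -, hA⟩ := hM
  have hx : M.IsNonloop x := hxy.isNonloop_of_mem (by simp)
  have hy : M.IsNonloop y := hxy.isNonloop_of_mem (by simp)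
  have hz : M.IsNonloop z := hxz.isNonloop_of_mem (by simp)
  obtain ⟨jx, hjx⟩ := exists_forall_mem_eq_of_parallel hA hx hx' hxx'
  obtain ⟨jy, hjy⟩ := exists_forall_mem_eq_of_parallel hA hy hy' hyy'
  obtain ⟨jz, hjz⟩ := exists_forall_mem_eq_of_parallel hA hz hz' hzz'
  have key : ∀ {a b : α} {ja jb : Fin m}, (∀ l, a ∈ A l → l = ja) → (∀ l, b ∈ A l → l = jb) →
      a ≠ b → M.Indep {a, b} → a ∈ A ja ∧ b ∈ A jb ∧ ja ≠ jb := by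
    intro a b ja jb ha hb hab hI
    obtain ⟨φ, hφ, hmem⟩ := (hA _ hI.subset_ground).1 hI
    have h1 := hmem ⟨a, by simp⟩
    have h2 := hmem ⟨b, by simp⟩
    obtain rfl := ha _ h1
    obtain rfl := hb _ h2
    exact ⟨h1, h2, fun h ↦ hab (congrArg Subtype.val (hφ h))⟩
  obtain ⟨mx, my, n1⟩ := key hjx hjy hne hxy
  obtain ⟨-, mz, n2⟩ := key hjx hjz hne' hxz
  obtain ⟨-, -, n3⟩ := key hjy hjz hne'' hyz
  classical
  refine (hA _ ?_).2 ⟨fun e ↦ if (e : α) = x then jx else if (e : α) = y then jy else jz, ?_, ?_⟩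
  · rintro e (rfl | rfl | rfl)
    exacts [hx.mem_ground, hy.mem_ground, hz.mem_ground]
  · rintro ⟨e, he⟩ ⟨f, hf⟩ h
    simp only [Set.mem_insert_iff, Set.mem_singleton_iff] at he hf
    grind
  · rintro ⟨e, he⟩
    simp only [Set.mem_insert_iff, Set.mem_singleton_iff] at he
    grind

lemma exampleN_isNonloop (e : Fin 10) : exampleN.IsNonloop e := by
  have h : ∀ e, ∃ j k, columnDet e j k ≠ 0 := by decide
  obtain ⟨j, k, hd⟩ := h e
  exact (exampleN_indep_triple hd).1.isNonloop_of_mem (by simp)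

lemma exampleN_not_isTransversal : ¬ exampleN.IsTransversal := by
  intro h
  have h3 : exampleN.Indep {4, 6, 8} := by
    refine h.indep_triple (x' := 5) (y' := 7) (z' := 9) (exampleN_isNonloop _)
      (exampleN_isNonloop _) (exampleN_isNonloop _) ?_ ?_ ?_ ?_ ?_ ?_ (by decide) (by decide)
      (by decide)
    all_goals
      rw [exampleN_indep_pair (by decide)]
      decide
  rw [exampleN_indep_triple_iff (by decide) (by decide) (by decide)] at h3
  exact h3 (by decide)

/-! ### Parallel classes, paving matroids and truncations -/

lemma six_le_encard_parallelClasses : 6 ≤ exampleN.parallelClasses.encard := by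
  have hcl : ∀ {e f : Fin 10}, f ≠ e → (∃ c, columnDet f e c ≠ 0) →
      f ∉ exampleN.closure {e} := by
    intro e f hne h
    have hI := (exampleN_indep_pair hne).2 h
    rwa [(exampleN_isNonloop e).indep.notMem_closure_iff_of_notMem (by simpa)]
  let rep : Fin 6 → Fin 10 := ![0, 1, 2, 4, 6, 8]
  let P : Fin 6 → Set (Fin 10) := fun t ↦
    {f | exampleN.IsNonloop f ∧ f ∈ exampleN.closure {rep t}}
  have hP : Function.Injective P := by
    intro s t hst
    by_contra hne
    have hdet : ∀ s t, s ≠ t → rep s ≠ rep t ∧ ∃ c, columnDet (rep s) (rep t) c ≠ 0 := by decide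
    have hmem : rep s ∈ P s := ⟨exampleN_isNonloop _, mem_closure_of_mem' _ rfl⟩
    rw [hst] at hmem
    exact hcl (hdet s t hne).1 (hdet s t hne).2 hmem.2
  have hsub : Set.range P ⊆ exampleN.parallelClasses := by
    rintro _ ⟨t, rfl⟩
    exact ⟨rep t, exampleN_isNonloop _, rfl⟩
  refine le_trans ?_ (Set.encard_le_encard hsub)
  rw [← Set.image_univ, hP.encard_image, Set.encard_univ]
  simp

lemma exampleM_indep_iff (I : Set (Fin 10)) : exampleM.Indep I ↔
    ∃ i j k, i < j ∧ j < k ∧ columnDet i j k ≠ 0 ∧ i ∉ I ∧ j ∉ I ∧ k ∉ I := by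
  rw [indep_iff]
  constructor
  · rintro ⟨B, hB, hI⟩
    obtain ⟨i, j, k, hij, hjk, hd, rfl⟩ := (exampleM_isBase_iff B).1 hB
    exact ⟨i, j, k, hij, hjk, hd, fun h ↦ hI h (by simp), fun h ↦ hI h (by simp),
      fun h ↦ hI h (by simp)⟩
  · rintro ⟨i, j, k, hij, hjk, hd, hi, hj, hk⟩
    refine ⟨_, (exampleM_isBase_iff _).2 ⟨i, j, k, hij, hjk, hd, rfl⟩, fun x hx ↦ ?_⟩
    rintro (rfl | rfl | rfl) <;> contradiction

/-- The complement of the line `{0, …, 5}` of `exampleN` is dependent in the dual. -/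
lemma exampleM_not_isPaving : ¬ exampleM.IsPaving := by
  intro h
  have hdep : exampleM.Dep {6, 7, 8, 9} := by
    rw [dep_iff, exampleM_indep_iff]
    refine ⟨?_, Set.subset_univ _⟩
    simp only [Set.mem_insert_iff, Set.mem_singleton_iff]
    decide +kernel
  obtain ⟨C, hC, hcirc⟩ := hdep.exists_isCircuit_subset
  have h1 := (h C hcirc).trans (Set.encard_le_encard hC)
  have h2 : ({6, 7, 8, 9} : Set (Fin 10)).encard ≤ 4 := by
    rw [show ({6, 7, 8, 9} : Set (Fin 10)) = (({6, 7, 8, 9} : Finset (Fin 10)) : Set (Fin 10)) by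
      simp, Set.encard_coe_eq_coe_finsetCard]
    rfl
  rw [exampleM_eRank] at h1
  exact absurd (h1.trans h2) (by decide)

/-- A truncation `M` of `N` to rank `k` has a set of `k + 1` elements, independent in `N`, all of
whose `k`-subsets are bases of `M`. -/
lemma IsTruncation.exists_indep_sdiff_singleton {α : Type*} {M : Matroid α} (h : M.IsTruncation) :
    ∃ J ⊆ M.E, J.encard = M.eRank + 1 ∧ ∀ x ∈ J, M.Indep (J \ {x}) := by
  obtain ⟨N, k, hE, hk, hI⟩ := h
  obtain ⟨B, hB⟩ := N.exists_isBase
  rw [← hB.encard_eq_eRank] at hk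
  obtain ⟨J, hJB, hJ⟩ := Set.exists_subset_encard_eq (Order.add_one_le_of_lt hk)
  have hJi : N.Indep J := hB.indep.subset hJB
  have hsub : ∀ x ∈ J, (J \ {x}).encard = k ∧ M.Indep (J \ {x}) := by
    intro x hx
    have hc : (J \ {x}).encard = k := by
      refine ENat.add_left_injective_of_ne_top ENat.one_ne_top ?_
      change (J \ {x}).encard + 1 = k + 1
      rw [Set.encard_sdiff_singleton_add_one hx, hJ]
    exact ⟨hc, (hI _).2 ⟨hJi.subset Set.sdiff_subset, hc.le⟩⟩
  have hr : M.eRank = k := by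
    refine le_antisymm ?_ ?_
    · obtain ⟨D, hD⟩ := M.exists_isBase
      exact hD.encard_eq_eRank ▸ ((hI D).1 hD.indep).2
    · obtain ⟨x, hx⟩ : J.Nonempty := by
        rw [← Set.encard_ne_zero, hJ]
        simp
      exact (hsub x hx).1 ▸ (hsub x hx).2.encard_le_eRank
  exact ⟨J, hE ▸ hJi.subset_ground, by rw [hJ, hr], fun x hx ↦ (hsub x hx).2⟩

/-- Every pair `a`, `b` is contained in a triple that is not a basis of `exampleN`, whereas the
eight-element set `J` of a truncation would make `Jᶜ` a pair all of whose three-element extensions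
are bases. -/
lemma exampleM_not_isTruncation : ¬ exampleM.IsTruncation := by
  intro h
  obtain ⟨J, -, hJ, hJI⟩ := h.exists_indep_sdiff_singleton
  have hcompl : Jᶜ.encard = 2 := by
    have h1 := Set.encard_add_encard_compl J
    rw [hJ, exampleM_eRank, Set.encard_univ, add_comm] at h1
    refine ENat.add_left_injective_of_ne_top (ENat.natCast_ne_top 8) ?_
    refine Eq.trans ?_ (h1.trans ?_) <;> norm_num
  obtain ⟨a, b, hab, hJab⟩ := Set.encard_eq_two.1 hcompl
  have hdep : ∀ a b : Fin 10, ∃ x, x ≠ a ∧ x ≠ b ∧ columnDet a b x = 0 := by decide +kernel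
  obtain ⟨x, hxa, hxb, hd⟩ := hdep a b
  have hxJ : x ∈ J := by
    by_contra hx
    have : x ∈ ({a, b} : Set (Fin 10)) := hJab ▸ hx
    simp [hxa, hxb] at this
  obtain ⟨B, hB, hBJ⟩ := (hJI x hxJ).exists_isBase_superset
  have hBN : exampleN.IsBase Bᶜ := by
    rw [Set.compl_eq_univ_sdiff, ← exampleM_dual]
    exact hB.compl_isBase_dual
  have hsub : Bᶜ ⊆ {a, b, x} := by
    intro y hy
    by_contra hn
    have hyJ : y ∈ Jᶜ ∨ y ∈ J := em' _
    grind
  have h3 := ((exampleN_isBase_iff_indep _).1 hBN).2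
  have heq : Bᶜ = {a, b, x} := by
    refine (Set.toFinite _).eq_of_subset_of_encard_le hsub ?_
    rw [h3, Set.encard_eq_three.2 ⟨a, b, x, hab, hxa.symm, hxb.symm, rfl⟩]
  exact (exampleN_isBase_triple a b x).1 (heq ▸ hBN) hd

/-! ### Internal perfection -/

/-- The increasing triples of indices of the bases of `exampleN`, whose complements are the bases
of `exampleM`. -/
def baseTriples : List (Fin 10 × Fin 10 × Fin 10) :=
  (List.finRange 10).flatMap fun i ↦ (List.finRange 10).flatMap fun j ↦
    (List.finRange 10).filterMap fun k ↦
      if i < j ∧ j < k ∧ columnDet i j k ≠ 0 then some (i, j, k) else none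

/-- The internally passive elements of the basis of `exampleM` complementary to `t`: those that may
replace a smaller element of the triple `t` in a basis of `exampleN`. -/
def passiveFinset (t : Fin 10 × Fin 10 × Fin 10) : Finset (Fin 10) :=
  {x | (x ≠ t.1 ∧ x ≠ t.2.1 ∧ x ≠ t.2.2) ∧
      (t.1 < x ∧ columnDet x t.2.1 t.2.2 ≠ 0 ∨ t.2.1 < x ∧ columnDet t.1 x t.2.2 ≠ 0 ∨
      t.2.2 < x ∧ columnDet t.1 t.2.1 x ≠ 0)}

/-- The sets of internally passive elements of the bases of `exampleM`. -/
def passiveFinsets : List (Finset (Fin 10)) := baseTriples.map passiveFinset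

/-- The sets of internally passive elements of the principal bases of `exampleM`, which form one
chain for each `f ∈ {3, 7, 9}`. -/
def principalFinsets : List (Finset (Fin 10)) :=
  [{3}, {2, 3}, {1, 2, 3},
    {7}, {6, 7}, {5, 6, 7}, {4, 5, 6, 7}, {1, 4, 5, 6, 7},
    {9}, {8, 9}, {5, 8, 9}, {4, 5, 8, 9}, {1, 4, 5, 8, 9}]

/-- A property of all members of a list follows from one Boolean computation. -/
lemma forall_mem_of_all {β : Type*} {l : List β} {p : β → Prop} [DecidablePred p]
    (h : l.all fun x ↦ p x) : ∀ x ∈ l, p x :=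
  fun x hx ↦ of_decide_eq_true (List.all_eq_true.1 h x hx)

lemma mem_baseTriples {t : Fin 10 × Fin 10 × Fin 10} : t ∈ baseTriples ↔
    t.1 < t.2.1 ∧ t.2.1 < t.2.2 ∧ columnDet t.1 t.2.1 t.2.2 ≠ 0 := by
  obtain ⟨i, j, k⟩ := t
  simp [baseTriples]

lemma exampleM_isBase_iff_mem_baseTriples (B : Set (Fin 10)) :
    exampleM.IsBase B ↔ ∃ t ∈ baseTriples, B = {t.1, t.2.1, t.2.2}ᶜ := by
  simp only [exampleM_isBase_iff, mem_baseTriples, Prod.exists, and_assoc]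

lemma exampleM_internallyActive_iff {i j k : Fin 10} (hij : i < j) (hjk : j < k)
    (hd : columnDet i j k ≠ 0) (x : Fin 10) :
    exampleM.InternallyActive {i, j, k}ᶜ x ↔ (x ≠ i ∧ x ≠ j ∧ x ≠ k) ∧
      (columnDet x j k ≠ 0 → x ≤ i) ∧ (columnDet i x k ≠ 0 → x ≤ j) ∧
      (columnDet i j x ≠ 0 → x ≤ k) := by
  have hB := (exampleN_isBase_triple i j k).2 hd
  have hcompl : ({i, j, k}ᶜᶜ : Set (Fin 10)) = {i, j, k} := compl_compl _
  rw [InternallyActive, fundCocircuit, exampleM_dual, exampleN_ground, ← Set.compl_eq_univ_sdiff,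
    hcompl]
  have hmem : x ∈ ({i, j, k}ᶜ : Set (Fin 10)) ↔ x ≠ i ∧ x ≠ j ∧ x ≠ k := by simp
  rw [hmem]
  refine and_congr_right fun ⟨hi, hj, hk⟩ ↦ ?_
  have hx : x ∉ ({i, j, k} : Set (Fin 10)) := by simp [hi, hj, hk]
  have hcl : x ∈ exampleN.closure {i, j, k} := by simp [hB.closure_eq]
  -- an element of the triple lies in the fundamental circuit of `x` iff `x` may replace it
  have h1 : i ∈ exampleN.fundCircuit x {i, j, k} ↔ columnDet x j k ≠ 0 := by
    rw [hB.indep.mem_fundCircuit_iff hcl hx,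
      ← exampleN_indep_triple_iff hj hk hjk.ne]
    have : insert x {i, j, k} \ {i} = ({x, j, k} : Set (Fin 10)) := by grind
    rw [this]
  have h2 : j ∈ exampleN.fundCircuit x {i, j, k} ↔ columnDet i x k ≠ 0 := by
    rw [hB.indep.mem_fundCircuit_iff hcl hx,
      ← exampleN_indep_triple_iff hi.symm (hij.trans hjk).ne hk]
    have : insert x {i, j, k} \ {j} = ({i, x, k} : Set (Fin 10)) := by grind
    rw [this]
  have h3 : k ∈ exampleN.fundCircuit x {i, j, k} ↔ columnDet i j x ≠ 0 := by
    rw [hB.indep.mem_fundCircuit_iff hcl hx,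
      ← exampleN_indep_triple_iff hij.ne hi.symm hj.symm]
    have : insert x {i, j, k} \ {k} = ({i, j, x} : Set (Fin 10)) := by grind
    rw [this]
  rw [← h1, ← h2, ← h3]
  refine ⟨fun h ↦ ⟨h i, h j, h k⟩, fun ⟨g1, g2, g3⟩ f hf ↦ ?_⟩
  rcases fundCircuit_subset_insert _ _ _ hf with rfl | rfl | rfl | rfl
  exacts [le_rfl, g1 hf, g2 hf, g3 hf]

lemma internallyPassive_eq {t : Fin 10 × Fin 10 × Fin 10} (ht : t ∈ baseTriples) :
    exampleM.internallyPassive {t.1, t.2.1, t.2.2}ᶜ = passiveFinset t := by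
  obtain ⟨hij, hjk, hd⟩ := mem_baseTriples.1 ht
  ext x
  have hmem : x ∈ ({t.1, t.2.1, t.2.2}ᶜ : Set (Fin 10)) ↔ x ≠ t.1 ∧ x ≠ t.2.1 ∧ x ≠ t.2.2 := by
    simp
  simp only [internallyPassive, Set.mem_ofPred_eq, exampleM_internallyActive_iff hij hjk hd, hmem,
    passiveFinset, Finset.mem_coe, Finset.mem_filter, Finset.mem_univ, true_and, ← not_le]
  tauto

lemma exists_internallyPassive_eq {B : Set (Fin 10)} (hB : exampleM.IsBase B) :
    ∃ b ∈ passiveFinsets, exampleM.internallyPassive B = b := by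
  obtain ⟨t, ht, rfl⟩ := (exampleM_isBase_iff_mem_baseTriples B).1 hB
  exact ⟨_, List.mem_map_of_mem ht, internallyPassive_eq ht⟩

lemma exists_isBase_internallyPassive_eq {b : Finset (Fin 10)} (hb : b ∈ passiveFinsets) :
    ∃ B, exampleM.IsBase B ∧ exampleM.internallyPassive B = b := by
  obtain ⟨t, ht, rfl⟩ := List.mem_map.1 hb
  exact ⟨_, (exampleM_isBase_iff_mem_baseTriples _).2 ⟨t, ht, rfl⟩, internallyPassive_eq ht⟩

lemma mem_principalFinsets_of_card_inter : ∀ p ∈ passiveFinsets, (p ∩ {3, 7, 9}).card = 1 →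
    p ∈ principalFinsets :=
  forall_mem_of_all (by decide +kernel)

lemma principalFinsets_subset : ∀ p ∈ principalFinsets,
    p ∈ passiveFinsets ∧ ∃ f : Fin 10, p ∩ {3, 7, 9} = {f} :=
  forall_mem_of_all (by decide +kernel)

/-- The complement of the lexicographically last basis `{3, 7, 9}` of `exampleN` is the initial
basis of the dual. -/
lemma isInitialBase_exampleM : exampleM.IsInitialBase {3, 7, 9}ᶜ := by
  refine ⟨(exampleM_isBase_iff _).2 ⟨3, 7, 9, by decide, by decide, by decide, rfl⟩, ?_⟩
  have hfirst : ∀ t ∈ baseTriples, t ≠ (3, 7, 9) → ∃ x : Fin 10,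
      ((x ≠ 3 ∧ x ≠ 7 ∧ x ≠ 9) ∧ (x = t.1 ∨ x = t.2.1 ∨ x = t.2.2)) ∧
      ∀ y < x, (y = 3 ∨ y = 7 ∨ y = 9 ↔ y = t.1 ∨ y = t.2.1 ∨ y = t.2.2) :=
    forall_mem_of_all (by decide +kernel)
  intro B hB hne
  obtain ⟨t, ht, rfl⟩ := (exampleM_isBase_iff_mem_baseTriples B).1 hB
  obtain ⟨x, hx, hy⟩ := hfirst t ht (by rintro rfl; exact hne rfl)
  exact ⟨x, by simpa using hx, fun y hyx ↦ not_congr (hy y hyx)⟩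

/-- Every internally passive element in the initial basis is already internally passive in a
principal basis below. -/
lemma exists_principal_of_mem_passive : ∀ b ∈ passiveFinsets, ∀ t ∈ b,
    t ∉ ({3, 7, 9} : Finset (Fin 10)) → ∃ p ∈ principalFinsets, p ⊆ b ∧ t ∈ p :=
  forall_mem_of_all (by decide +kernel)

/-- Two principal sets from different chains that share an element of the initial basis have a
dependent union. -/
lemma inter_subset_of_principal_of_ne : ∀ p ∈ principalFinsets, ∀ q ∈ principalFinsets,
    p ∩ {3, 7, 9} ≠ q ∩ {3, 7, 9} → p ∩ q ⊆ {3, 7, 9} ∨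
      ∀ t ∈ baseTriples, t.1 ∈ p ∪ q ∨ t.2.1 ∈ p ∪ q ∨ t.2.2 ∈ p ∪ q := by
  have h : principalFinsets.all fun p ↦ principalFinsets.all fun q ↦
      p ∩ {3, 7, 9} ≠ q ∩ {3, 7, 9} → p ∩ q ⊆ {3, 7, 9} ∨
        baseTriples.all fun t ↦ t.1 ∈ p ∪ q ∨ t.2.1 ∈ p ∪ q ∨ t.2.2 ∈ p ∪ q := by
    decide +kernel
  intro p hp q hq hne
  exact (forall_mem_of_all (List.all_eq_true.1 h p hp) q hq hne).imp_right forall_mem_of_all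

lemma internalS_eq_singleton_iff {P : Set (Fin 10)} {p : Finset (Fin 10)} {f : Fin 10}
    (hp : exampleM.internallyPassive P = p) :
    exampleM.internalS {3, 7, 9}ᶜ P = {f} ↔ p ∩ {3, 7, 9} = {f} := by
  rw [internalS, hp, ← Finset.coe_inj, Set.sdiff_compl]
  push_cast
  rfl

lemma isPerfectBase_exampleM {B : Set (Fin 10)} (hB : exampleM.IsBase B) :
    exampleM.IsPerfectBase {3, 7, 9}ᶜ B := by
  obtain ⟨b, hb, hbB⟩ := exists_internallyPassive_eq hB
  constructor
  · ext t
    simp only [Set.mem_iUnion, internalPart, Set.mem_ofPred_eq, exists_prop]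
    constructor
    · rintro ⟨f, -, P, -, hPB, htP⟩
      exact ⟨hPB htP.1, htP.2⟩
    · rintro ⟨htB, ht0⟩
      obtain ⟨p, hp, hpb, htp⟩ := exists_principal_of_mem_passive b hb t
        (by rw [hbB] at htB; exact htB) (by simpa using ht0)
      obtain ⟨hp, f, hf⟩ := principalFinsets_subset p hp
      obtain ⟨P, hP, hpP⟩ := exists_isBase_internallyPassive_eq hp
      have hS := (internalS_eq_singleton_iff hpP).2 hf
      have hPB : exampleM.InternalLE P B := by
        rw [InternalLE, hpP, hbB]
        exact_mod_cast hpb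
      have hfS : f ∈ exampleM.internalS {3, 7, 9}ᶜ P := hS ▸ rfl
      exact ⟨f, ⟨hPB hfS.1, hfS.2⟩, P, ⟨hP, hS⟩, hPB, by rw [hpP]; exact htp, ht0⟩
  · intro f _ g _ hfg
    refine Set.disjoint_left.2 ?_
    rintro t ⟨P, ⟨hP, hPf⟩, hPB, htP⟩ ⟨Q, ⟨hQ, hQg⟩, hQB, htQ⟩
    obtain ⟨p, hp, hpP⟩ := exists_internallyPassive_eq hP
    obtain ⟨q, hq, hqQ⟩ := exists_internallyPassive_eq hQ
    have hpf := (internalS_eq_singleton_iff hpP).1 hPf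
    have hqg := (internalS_eq_singleton_iff hqQ).1 hQg
    rw [InternalLE, hbB] at hPB hQB
    have htp : t ∈ exampleM.internallyPassive P := htP.1
    have htq : t ∈ exampleM.internallyPassive Q := htQ.1
    rw [hpP] at hPB htp
    rw [hqQ] at hQB htq
    rcases inter_subset_of_principal_of_ne
      p (mem_principalFinsets_of_card_inter p hp (by simp [hpf]))
      q (mem_principalFinsets_of_card_inter q hq (by simp [hqg])) (by simpa [hpf, hqg]) with h | h
    · exact htP.2 (by simpa using h (Finset.mem_inter.2 ⟨htp, htq⟩))
    · -- both passive sets lie in `B`, so their union is independent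
      have hpq : ((p ∪ q : Finset (Fin 10)) : Set (Fin 10)) ⊆ B := by
        rw [Finset.coe_union]
        refine (Set.union_subset hPB hQB).trans ?_
        rw [← hbB]
        exact fun x hx ↦ hx.1
      obtain ⟨i, j, k, hij, hjk, hd, hi, hj, hk⟩ :=
        (exampleM_indep_iff _).1 (hB.indep.subset hpq)
      rcases h (i, j, k) (mem_baseTriples.2 ⟨hij, hjk, hd⟩) with h | h | h
      exacts [hi h, hj h, hk h]

/-! ### The `h`-vector -/

lemma numIndep_exampleM (i : ℕ) : exampleM.numIndep i =
    ((Finset.univ.powersetCard i).filter fun s : Finset (Fin 10) ↦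
      baseTriples.any fun t ↦ t.1 ∉ s ∧ t.2.1 ∉ s ∧ t.2.2 ∉ s).card := by
  rw [numIndep, ← Set.ncard_coe_finset, ← Set.ncard_image_of_injective _ Finset.coe_injective]
  congr 1
  ext I
  simp only [Set.mem_ofPred_eq, Set.mem_image, Finset.mem_coe, Finset.mem_filter,
    Finset.mem_powersetCard, Finset.subset_univ, true_and, List.any_eq_true,
    decide_eq_true_eq, exampleM_indep_iff, mem_baseTriples, Prod.exists, and_assoc]
  constructor
  · rintro ⟨h, hI⟩
    refine ⟨I.toFinite.toFinset, ?_, by simpa using h, by simp⟩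
    rw [Set.Finite.encard_eq_coe_toFinset_card I.toFinite] at hI
    exact_mod_cast hI
  · rintro ⟨s, rfl, h, rfl⟩
    exact ⟨by simpa using h, Set.encard_coe_eq_coe_finsetCard s⟩

/-- As `7` is the rank, every binomial coefficient in the formula for `h₇` is `1`. -/
lemma hEntry_seven_exampleM : exampleM.hEntry 7 = 6 := by
  have h0 : exampleM.numIndep 0 = 1 := by rw [numIndep_exampleM]; decide +kernel
  have h1 : exampleM.numIndep 1 = 10 := by rw [numIndep_exampleM]; decide +kernel
  have h2 : exampleM.numIndep 2 = 45 := by rw [numIndep_exampleM]; decide +kernel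
  have h3 : exampleM.numIndep 3 = 120 := by rw [numIndep_exampleM]; decide +kernel
  have h4 : exampleM.numIndep 4 = 208 := by rw [numIndep_exampleM]; decide +kernel
  have h5 : exampleM.numIndep 5 = 240 := by rw [numIndep_exampleM]; decide +kernel
  have h6 : exampleM.numIndep 6 = 178 := by rw [numIndep_exampleM]; decide +kernel
  have h7 : exampleM.numIndep 7 = 68 := by rw [numIndep_exampleM]; decide +kernel
  have hr : exampleM.eRank.toNat = 7 := by rw [exampleM_eRank]; rfl
  simp [hEntry, Finset.sum_range_succ, hr, h0, h1, h2, h3, h4, h5, h6, h7]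

end Matroid

theorem mainTheorem3 :
    Matroid.exampleN.eRank = 3 ∧
    Matroid.exampleM.eRank = 7 ∧
    Matroid.exampleM.IsInternallyPerfect ∧
    -- the dual is not graphic
    ¬ Matroid.exampleM✶.IsGraphic ∧
    -- the dual is not transversal
    ¬ Matroid.exampleM✶.IsTransversal ∧
    -- the dual does not have at most `n - r + 2` parallel classes
    ¬ (Matroid.exampleM✶.parallelClasses.encard + Matroid.exampleM.eRank ≤
        Matroid.exampleM.E.encard + 2) ∧
    -- neither `n ≤ 9` nor corank at most `2`
    ¬ (Matroid.exampleM.E.encard ≤ 9 ∨ Matroid.exampleM✶.eRank ≤ 2) ∧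
    -- the rank is not at most `4`
    ¬ (Matroid.exampleM.eRank ≤ 4) ∧
    ¬ Matroid.exampleM.IsPaving ∧
    ¬ Matroid.exampleM.IsTruncation ∧
    -- the last nonzero entry of the `h`-vector is not at most `5`
    (∃ s, Matroid.exampleM.IsLastHIndex s ∧ ¬ Matroid.exampleM.hEntry s ≤ 5) := by
  open Matroid in
  refine ⟨exampleN_eRank, exampleM_eRank, ⟨_, isInitialBase_exampleM, fun B ↦
    isPerfectBase_exampleM⟩, ?_, ?_, ?_, ?_, ?_, exampleM_not_isPaving, exampleM_not_isTruncation,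
    7, ⟨?_, ?_, ?_⟩, ?_⟩
  · exact exampleM_dual ▸ exampleN_not_isGraphic
  · exact exampleM_dual ▸ exampleN_not_isTransversal
  · rw [exampleM_dual, exampleM_eRank, exampleM_ground, not_le]
    calc (Set.univ : Set (Fin 10)).encard + 2 = 12 := by rw [Set.encard_univ]; norm_num
      _ < 6 + 7 := by decide
      _ ≤ _ := by gcongr; exact six_le_encard_parallelClasses
  · rw [exampleM_dual, exampleN_eRank, exampleM_ground, Set.encard_univ]
    norm_num
  · rw [exampleM_eRank]
    decide
  · rw [exampleM_eRank]
    rfl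
  · rw [hEntry_seven_exampleM]
    decide
  · intro j h1 h2
    rw [exampleM_eRank] at h2
    exact absurd h2 (not_le.2 h1)
  · rw [hEntry_seven_exampleM]
    decide
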